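/- Let $K$ be a finite field, $s\ge 2$, and let $A_1,\dots,A_s\subseteq K$ be such that (i) $\{0,1\}\subseteq A_i$ for all $i$; (ii) $a/b\in A_j$ whenever $1\le i<j\le s$, $a\in A_j$ and $0\ne b\in A_i$; (iii) $d_1\le\cdots\le d_s$, where $d_i=|A_i|$. Let $\mathcal X=[A_1\times\cdots\times A_s]\subset\mathbb P^{s-1}$ be the image of $(A_1\times\cdots\times A_s)\setminus\{0\}$ (a projective nested cartesian set). Let $S=K[t_1,\dots,t_s]=\bigoplus_{d\ge 0}S_d$ with the standard grading, and let $I(\mathcal X)\subset S$ be the ideal generated by the homogeneous polynomials that vanish on $\mathcal X$. For homogeneous $f\in S$ let $V_{\mathcal X}(f)$ be the set of zeros of $f$ in $\mathcal X$. For a graded ideal $I\subsetneq S$ with $H_I(n)=\dim_K (S_n/(I\cap S_n))$ and $k'=\dim S/I$ (Krull dimension), let $\deg(S/I)=(k'-1)!\lim_{n\to\infty}H_I(n)/n^{k'-1}$ if $k'\ge 1$, and $\deg(S/I)=\dim_K(S/I)$ if $k'=0$. Let $\mathcal L_d\subset S_d$ be the $K$-span of all monomials of degree $d$ that are divisible by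 $t_1$. Suppose $1\le d\le\sum_{i=2}^s(d_i-1)$. Then there are unique integers $0\le k\le s-2$ and $\ell$ with $d=\sum_{i=2}^{k+1}(d_i-1)+\ell$ and $1\le\ell\le d_{k+2}-1$, and $$\max\{|V_{\mathcal X}(f)| : f\in\mathcal L_d,\ f\notin I(\mathcal X)\}=\deg(S/I(\mathcal X))-(d_{k+2}-\ell+1)\,d_{k+3}\cdots d_s .$$ Moreover, write $\mathcal X=\{[P_1],\dots,[P_m]\}$ with $m=|\mathcal X|$, choose $f_i\in S_d$ with $f_i(P_i)\neq 0$, and let $\mathrm{ev}_d:S_d\to K^m$, $f\mapsto (f(P_1)/f_1(P_1),\dots,f(P_m)/f_m(P_m))$. Then, for every choice of the $P_i$ and $f_i$, the linear code $\mathrm{ev}_d(\mathcal L_d)$ has minimum distance (the least number of non-zero entries of a non-zero codeword) equal to $(d_{k+2}-\ell+1)\,d_{k+3}\cdots d_s$. -/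

import Mathlib

open MvPolynomial LinearAlgebra.Projectivization

namespace NestedCartesian

noncomputable section

/-! ### Projective sets of points, zero sets and vanishing ideals -/

/-- The polynomial `f` vanishes at the point `p` of projective space, that is, at every
representative of `p`.  (For homogeneous `f` it makes no difference which one is taken.) -/
def VanishesAt {K : Type*} [Field K] {s : ℕ} (f : MvPolynomial (Fin s) K)
    (p : ℙ K (Fin s → K)) : Prop :=
  ∀ (v : Fin s → K) (hv : v ≠ 0), Projectivization.mk K v hv = p → eval v f = 0

/-- `V_X(f)`: the set of zeros of `f` in `X`. -/
def zeroSet {K : Type*} [Field K] {s : ℕ} (X : Set (ℙ K (Fin s → K)))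
    (f : MvPolynomial (Fin s) K) : Set (ℙ K (Fin s → K)) :=
  {p | p ∈ X ∧ VanishesAt f p}

/-- `I(X)`: the ideal generated by the homogeneous polynomials that vanish at all points
of `X`. -/
def projVanishingIdeal {K : Type*} [Field K] {s : ℕ} (X : Set (ℙ K (Fin s → K))) :
    Ideal (MvPolynomial (Fin s) K) :=
  Ideal.span {f | (∃ n, f.IsHomogeneous n) ∧ ∀ p ∈ X, VanishesAt f p}

/-! ### Hilbert function and degree -/

/-- The Hilbert function `H_I(n) = dim_K (S_n / I_n)`, where `I_n = I ∩ S_n`. -/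
def hilbertFunction {K : Type*} [Field K] {s : ℕ} (I : Ideal (MvPolynomial (Fin s) K))
    (n : ℕ) : ℕ :=
  Module.finrank K (homogeneousSubmodule (Fin s) K n ⧸
    (I.restrictScalars K).submoduleOf (homogeneousSubmodule (Fin s) K n))

/-- `deg (S/I) = e`: with `k` the Krull dimension of `S/I`, the number `e` is
`(k-1)! * lim H_I(n) / n^(k-1)` if `k ≥ 1`, and `dim_K (S/I)` if `k = 0`. -/
def HasDegree {K : Type*} [Field K] {s : ℕ} (I : Ideal (MvPolynomial (Fin s) K))
    (e : ℕ) : Prop :=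
  ∃ k : ℕ, ringKrullDim (MvPolynomial (Fin s) K ⧸ I) = (k : WithBot ℕ∞) ∧
    ((1 ≤ k ∧ Filter.Tendsto
        (fun n : ℕ => ((k - 1).factorial : ℝ) * ((hilbertFunction I n : ℝ) / (n : ℝ) ^ (k - 1)))
        Filter.atTop (nhds (e : ℝ))) ∨
     (k = 0 ∧ Module.Finite K (MvPolynomial (Fin s) K ⧸ I) ∧
        Module.finrank K (MvPolynomial (Fin s) K ⧸ I) = e))

/-! ### Projective nested cartesian sets.
The sets `A_1, …, A_s` are indexed by `Fin s`, so `A_i` is `A (i - 1)`. -/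

/-- The image of `A_1 × ⋯ × A_s \ {0}` in projective space. -/
def cartesianSet {K : Type*} [Field K] {s : ℕ} (A : Fin s → Finset K) :
    Set (ℙ K (Fin s → K)) :=
  {p | ∃ (v : Fin s → K) (hv : v ≠ 0), (∀ i, v i ∈ A i) ∧ p = Projectivization.mk K v hv}

/-- The conditions under which `cartesianSet A` is a projective nested cartesian set. -/
structure IsNested {K : Type*} [Field K] {s : ℕ} (A : Fin s → Finset K) : Prop where
  zero_mem : ∀ i, (0 : K) ∈ A i
  one_mem : ∀ i, (1 : K) ∈ A i
  div_mem : ∀ i j, i < j → ∀ a ∈ A j, ∀ b ∈ A i, b ≠ 0 → a / b ∈ A j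
  card_mono : ∀ i j, i ≤ j → (A i).card ≤ (A j).card

/-- With `d_i = |A_i|`: the integers `k` and `ℓ` satisfy `0 ≤ k ≤ s - 2`,
`d = ∑_{i=2}^{k+1} (d_i - 1) + ℓ` and `1 ≤ ℓ ≤ d_{k+2} - 1`.
The index `k + 2`, counted from one, is the element `k + 1` of `Fin s`. -/
def IsDecomposition {K : Type*} {s : ℕ} [NeZero s] (A : Fin s → Finset K)
    (d k ℓ : ℕ) : Prop :=
  ∃ hk : k + 1 < s,
    d = (∑ i ∈ Finset.Ioo (0 : Fin s) ⟨k + 1, hk⟩, ((A i).card - 1)) + ℓ ∧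
    1 ≤ ℓ ∧ ℓ ≤ (A ⟨k + 1, hk⟩).card - 1

/-- The number `(d_{k+2} - ℓ + 1) d_{k+3} ⋯ d_s`. (It is used for `ℓ ≤ d_{k+2} - 1` only,
where the subtraction of natural numbers is the usual one.) -/
def proposedDistance {K : Type*} {s : ℕ} (A : Fin s → Finset K)
    (k ℓ : ℕ) (hk : k + 1 < s) : ℕ :=
  ((A ⟨k + 1, hk⟩).card - ℓ + 1) * ∏ i ∈ Finset.Ioi (⟨k + 1, hk⟩ : Fin s), (A i).card

/-! ### Evaluation codes -/

/-- `L_d`: the span of all monomials of degree `d` that are divisible by `t_1`. -/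
def monomialSpan (K : Type*) [Field K] (s : ℕ) [NeZero s] (d : ℕ) :
    Submodule K (MvPolynomial (Fin s) K) :=
  Submodule.span K {f | ∃ a : Fin s →₀ ℕ, a.degree = d ∧ 1 ≤ a 0 ∧ f = monomial a 1}

/-- The evaluation map `ev_d : S_d → K^X`, `f ↦ (f(P_x) / g_x(P_x))_x`, with respect to
vectors `P_x` and polynomials `g_x`. -/
def evalMap {K : Type*} [Field K] {s : ℕ} (X : Set (ℙ K (Fin s → K))) (d : ℕ)
    (P : X → Fin s → K) (g : X → MvPolynomial (Fin s) K) :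
    homogeneousSubmodule (Fin s) K d →ₗ[K] (X → K) where
  toFun f := fun x => eval (P x) (f : MvPolynomial (Fin s) K) / eval (P x) (g x)
  map_add' f f' := by
    funext x
    simp [add_div]
  map_smul' c f := by
    funext x
    simp [mul_div_assoc]

/-- Admissible data for the evaluation map: `P_x` is a representative of the point `x`, and
`g_x` is a homogeneous polynomial of degree `d` that does not vanish at `P_x`. -/
def IsEvalData {K : Type*} [Field K] {s : ℕ} (X : Set (ℙ K (Fin s → K))) (d : ℕ)
    (P : X → Fin s → K) (g : X → MvPolynomial (Fin s) K) : Prop :=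
  ∀ x : X, (∃ h : P x ≠ 0, Projectivization.mk K (P x) h = (x : ℙ K (Fin s → K))) ∧
    (g x).IsHomogeneous d ∧ eval (P x) (g x) ≠ 0

/-- The minimum distance of the linear code `C` exists and is equal to `δ`. -/
def IsMinimumDistance {K ι : Type*} [Field K] [DecidableEq K] [Fintype ι]
    (C : Submodule K (ι → K)) (δ : ℕ) : Prop :=
  IsLeast {w : ℕ | ∃ v ∈ C, v ≠ 0 ∧ hammingNorm v = w} δ

end

end NestedCartesian

/-! A form `f` in `L_d` is `t_1 * h` with `h` a form of degree `d - 1`, so it can be non-zero only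
at points with `t_1 ≠ 0`. By the quotient condition (ii) such a point has exactly one representative
`(1, x)`, and `x` runs over the affine grid `A_2 × ⋯ × A_s`. Hence the non-zeros of `f` in the
projective set are counted by those of `h(1, x)`, of degree at most `d - 1`, on the grid
(`ncard_nonzeroSet_X_mul`).

The Alon–Füredi theorem (`exists_prod_le_card_eval_ne_zero`) bounds that count below by some `∏ y_i`
with `1 ≤ y_i ≤ d_i` and `∑ (d_i - y_i) ≤ d - 1`. The product is least when the smallest `d_i` are
exhausted first (`mul_prod_le_prod`). As `d - 1 = ∑_{i=2}^{k+1} (d_i - 1) + (ℓ - 1)`, this leaves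
`(d_{k+2} - ℓ + 1) d_{k+3} ⋯ d_s`. A product of linear forms `t_i - c t_1` attains the bound
(`exists_ncard_nonzeroSet_eq`).

Finally, the degree of a finite non-empty set of points is its cardinality, so counting zeros is
complementary to counting non-zeros, and the weight of a codeword is the number of non-zeros of its
form. -/

namespace NestedCartesian

noncomputable section

/-! ### A product inequality -/

/-- Among the integer points `y` of the box `∏ [1, d i]` with `d` monotone whose total defect
`∑ (d i - y i)` is bounded, the product is smallest when the defect is spent greedily on the
smallest `d i`. -/
theorem mul_prod_le_prod (n : ℕ) : ∀ (d y : ℕ → ℕ) (k m r : ℕ), n = k + 1 + r →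
    (∀ i j, i ≤ j → j < n → d i ≤ d j) → (∀ i < n, 1 ≤ y i ∧ y i ≤ d i) → 1 ≤ m → m ≤ d k →
    ∑ i ∈ Finset.range n, (d i - y i) ≤ ∑ i ∈ Finset.range k, (d i - 1) + (d k - m) →
    m * ∏ i ∈ Finset.range r, d (k + 1 + i) ≤ ∏ i ∈ Finset.range n, y i := by
  induction n with
  | zero => intro d y k m r hn; omega
  | succ n ih =>
    intro d y k m r hn hd hy hm hmk h
    have hy0 := hy 0 (by omega)
    have hy' : ∀ i < n, 1 ≤ y (i + 1) ∧ y (i + 1) ≤ d (i + 1) := fun i hi => hy _ (by omega)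
    have hd' : ∀ i j, i ≤ j → j < n → d (i + 1) ≤ d (j + 1) :=
      fun i j hij hj => hd _ _ (by omega) (by omega)
    have hpos : 1 ≤ ∏ i ∈ Finset.range n, y (i + 1) :=
      Finset.one_le_prod' fun i hi => (hy' i (Finset.mem_range.1 hi)).1
    rw [Finset.prod_range_succ']
    rw [Finset.sum_range_succ'] at h
    by_cases hmy : m ≤ y 0
    · rcases r with _ | r
      · simp only [Finset.range_zero, Finset.prod_empty, mul_one]
        calc m ≤ 1 * y 0 := by omega
          _ ≤ _ := Nat.mul_le_mul_right _ hpos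
      · have hdk : d 0 ≤ d (k + 1) := hd _ _ (by omega) (by omega)
        -- The budget left to the tail brings `d 1, …, d k` down to 1 and takes a further `y 0 - m`
        -- off `d (k + 1)`.
        have key := ih (fun i => d (i + 1)) (fun i => y (i + 1)) k (d (k + 1) - (y 0 - m)) r
          (by omega) hd' hy' (by omega) (by omega) (by
            rcases k with _ | k
            · simp only [Finset.range_zero, Finset.sum_empty] at h ⊢
              omega
            · rw [Finset.sum_range_succ'] at h
              rw [Finset.sum_range_succ]
              omega)
        -- Both pairs of factors have the same sum; as `m ≤ y 0 ≤ d (k + 1)`, the pair on the left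
        -- is the more spread out, so its product is smaller.
        have hfac : m * d (k + 1) ≤ (d (k + 1) - (y 0 - m)) * y 0 := by
          obtain ⟨u, hu⟩ := Nat.exists_eq_add_of_le hmy
          obtain ⟨w, hw⟩ := Nat.exists_eq_add_of_le (hy0.2.trans hdk)
          rw [show d (k + 1) - (y 0 - m) = m + w by omega, hw, hu]
          nlinarith [Nat.zero_le (u * w)]
        rw [Finset.prod_range_succ']
        calc m * ((∏ i ∈ Finset.range r, d (k + 1 + (i + 1))) * d (k + 1 + 0))
            = (m * d (k + 1)) * ∏ i ∈ Finset.range r, d (k + 1 + (i + 1)) := by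
              rw [Nat.add_zero]; ring
          _ ≤ ((d (k + 1) - (y 0 - m)) * y 0) * ∏ i ∈ Finset.range r, d (k + 1 + (i + 1)) :=
              Nat.mul_le_mul_right _ hfac
          _ = ((d (k + 1) - (y 0 - m)) * ∏ i ∈ Finset.range r, d (k + 1 + (i + 1))) * y 0 := by
              ring
          _ ≤ _ := Nat.mul_le_mul_right _ key
    · rcases k with _ | k
      · simp only [Finset.range_zero, Finset.sum_empty] at h
        omega
      -- Slot 0 stays `y 0 - 1` above the greedy value 1, and the tail spends that amount on the
      -- slot that held `m`. Then `hfac` compares the pairs `(m, 1)` and `(m - (y 0 - 1), y 0)`,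
      -- again of equal sum.
      · have key := ih (fun i => d (i + 1)) (fun i => y (i + 1)) k (m - (y 0 - 1)) r
          (by omega) hd' hy' (by omega) (by omega) (by
            rw [Finset.sum_range_succ'] at h
            omega)
        have hfac : m ≤ (m - (y 0 - 1)) * y 0 := by
          obtain ⟨u, hu⟩ := Nat.exists_eq_add_of_le hy0.1
          obtain ⟨w, hw⟩ := Nat.exists_eq_add_of_lt (not_le.1 hmy)
          rw [show m - (y 0 - 1) = w + 2 by omega, hw, hu]
          nlinarith [Nat.zero_le (u * w)]
        have hshift : ∏ i ∈ Finset.range r, d (k + 1 + i + 1)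
            = ∏ i ∈ Finset.range r, d (k + 1 + 1 + i) :=
          Finset.prod_congr rfl fun i _ => by congr 1; omega
        rw [hshift] at key
        calc m * ∏ i ∈ Finset.range r, d (k + 1 + 1 + i)
            ≤ ((m - (y 0 - 1)) * y 0) * ∏ i ∈ Finset.range r, d (k + 1 + 1 + i) :=
              Nat.mul_le_mul_right _ hfac
          _ = ((m - (y 0 - 1)) * ∏ i ∈ Finset.range r, d (k + 1 + 1 + i)) * y 0 := by ring
          _ ≤ _ := Nat.mul_le_mul_right _ key

/-! ### Non-zeros of polynomials on affine grids -/

section Grid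

variable {K : Type*} [Field K]

theorem totalDegree_aeval_le_of_linear {σ τ : Type*} [Fintype σ] (f : σ → MvPolynomial τ K)
    (hf : ∀ i, (f i).totalDegree ≤ 1) (p : MvPolynomial σ K) :
    (aeval f p).totalDegree ≤ p.totalDegree := by
  rw [aeval_eq_eval₂Hom, coe_eval₂Hom, eval₂_eq']
  refine totalDegree_finsetSum_le fun m hm => ?_
  refine (totalDegree_mul _ _).trans ?_
  rw [algebraMap_eq, totalDegree_C, zero_add]
  refine (totalDegree_finsetProd _ _).trans ?_
  refine le_trans (Finset.sum_le_sum (g := fun i => m i) fun i _ => ?_) ?_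
  · exact (totalDegree_pow _ _).trans (by simpa using Nat.mul_le_mul_left (m i) (hf i))
  · simpa [Finsupp.sum_fintype] using le_totalDegree hm

/-- The restriction of a polynomial to the hyperplane `x₀ = a`. -/
def restrictZero {n : ℕ} (a : K) (g : MvPolynomial (Fin (n + 1)) K) : MvPolynomial (Fin n) K :=
  aeval (Fin.cons (C a) X) g

theorem totalDegree_restrictZero_le {n : ℕ} (a : K) (g : MvPolynomial (Fin (n + 1)) K) :
    (restrictZero a g).totalDegree ≤ g.totalDegree := by
  refine totalDegree_aeval_le_of_linear _ (fun i => ?_) g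
  refine Fin.cases ?_ (fun j => ?_) i
  · simp
  · simp

theorem eval_restrictZero {n : ℕ} (a : K) (g : MvPolynomial (Fin (n + 1)) K) (x : Fin n → K) :
    eval x (restrictZero a g) = eval (Fin.cons a x : Fin (n + 1) → K) g := by
  unfold restrictZero
  rw [aeval_def, algebraMap_eq, eval_eval₂]
  have : (eval x).comp (C : K →+* MvPolynomial (Fin n) K) = RingHom.id K := by
    ext; simp
  rw [this, ← eval₂_id]
  congr 1
  funext i
  refine Fin.cases ?_ (fun j => ?_) i <;> simp

/-- Division by `x₀ - a`: each power `x₀ ^ e - a ^ e` is `x₀ - a` times a geometric sum, and the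
remainder is the restriction to `x₀ = a`. -/
theorem exists_eval_eq_sub_mul_add {n : ℕ} (a : K) (g : MvPolynomial (Fin (n + 1)) K) :
    ∃ q : MvPolynomial (Fin (n + 1)) K, q.totalDegree ≤ g.totalDegree - 1 ∧
      ∀ v : Fin (n + 1) → K, eval v g =
        (v 0 - a) * eval v q + eval (Fin.cons a (Fin.tail v) : Fin (n + 1) → K) g := by
  refine ⟨∑ m ∈ g.support, C (coeff m g) *
    ((∑ i ∈ Finset.range (m 0), X 0 ^ i * C a ^ (m 0 - 1 - i)) *
      ∏ j : Fin n, X j.succ ^ m j.succ), ?_, fun v => ?_⟩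
  · refine totalDegree_finsetSum_le fun m hm => ?_
    rw [Finset.sum_mul, Finset.mul_sum]
    refine totalDegree_finsetSum_le fun i hi => ?_
    have hi' := Finset.mem_range.1 hi
    have h1 : m 0 + ∑ j : Fin n, m j.succ ≤ g.totalDegree := by
      simpa [Finsupp.sum_fintype, Fin.sum_univ_succ] using le_totalDegree hm
    have h2 : (∏ j : Fin n, (X j.succ : MvPolynomial (Fin (n + 1)) K) ^ m j.succ).totalDegree
        ≤ ∑ j : Fin n, m j.succ :=
      (totalDegree_finsetProd _ _).trans (Finset.sum_le_sum fun j _ => by simp)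
    have h3 : (X 0 ^ i * C a ^ (m 0 - 1 - i) : MvPolynomial (Fin (n + 1)) K).totalDegree ≤ i := by
      refine (totalDegree_mul _ _).trans ?_
      rw [← C_pow, totalDegree_C]
      simp
    refine (totalDegree_mul _ _).trans ?_
    rw [totalDegree_C]
    have h4 := totalDegree_mul (X 0 ^ i * C a ^ (m 0 - 1 - i) : MvPolynomial (Fin (n + 1)) K)
      (∏ j : Fin n, X j.succ ^ m j.succ)
    omega
  · rw [eval_eq' v g, eval_eq' _ g, map_sum, Finset.mul_sum, ← Finset.sum_add_distrib]
    refine Finset.sum_congr rfl fun m _ => ?_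
    simp only [Fin.prod_univ_succ, map_mul, map_sum, map_prod, map_pow, eval_C, eval_X,
      Fin.cons_zero, Fin.cons_succ, Fin.tail]
    have := geom_sum₂_mul (v 0) a (m 0)
    linear_combination (-coeff m g * ∏ j : Fin n, v j.succ ^ m j.succ) * this

/-- The factors `x₀ - a` are split off one at a time. Each remainder vanishes on the grid only, so
the factorization is one of functions on the grid, but the degree still drops by one per factor. -/
theorem exists_eval_eq_prod_mul {n : ℕ} (B : Fin (n + 1) → Finset K)
    (g : MvPolynomial (Fin (n + 1)) K) (hg : ∃ v, (∀ i, v i ∈ B i) ∧ eval v g ≠ 0)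
    (Z : Finset K) : Z ⊆ B 0 →
    (∀ a ∈ Z, ∀ v, (∀ i, v i ∈ B i) → v 0 = a → eval v g = 0) →
    ∃ h : MvPolynomial (Fin (n + 1)) K, h.totalDegree + Z.card ≤ g.totalDegree ∧
      ∀ v, (∀ i, v i ∈ B i) → eval v g = (∏ a ∈ Z, (v 0 - a)) * eval v h := by
  classical
  induction Z using Finset.induction_on with
  | empty => intro _ _; exact ⟨g, by simp, by simp⟩
  | insert a Z ha ih =>
    intro hZB hZ
    obtain ⟨h, hdeg, hh⟩ := ih (fun b hb => hZB (Finset.mem_insert_of_mem hb))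
      (fun b hb => hZ b (Finset.mem_insert_of_mem hb))
    have hvan : ∀ v, (∀ i, v i ∈ B i) →
        eval (Fin.cons a (Fin.tail v) : Fin (n + 1) → K) h = 0 := by
      intro v hv
      have hmem : ∀ i, (Fin.cons a (Fin.tail v) : Fin (n + 1) → K) i ∈ B i := by
        intro i
        refine Fin.cases ?_ (fun j => ?_) i
        · simpa using hZB (Finset.mem_insert_self a Z)
        · simpa [Fin.tail] using hv j.succ
      have h0 := hZ a (Finset.mem_insert_self a Z) _ hmem (by simp)
      rw [hh _ hmem] at h0
      refine (mul_eq_zero.1 h0).resolve_left (Finset.prod_ne_zero_iff.2 fun b hb => ?_)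
      simp only [Fin.cons_zero]
      exact sub_ne_zero.2 fun hab => ha (hab ▸ hb)
    -- The bound `h.totalDegree - 1` is truncated, so a constant `h` must be excluded: vanishing on
    -- the slice, it would be zero, and `g` would vanish on the whole grid.
    have hpos : 1 ≤ h.totalDegree := by
      by_contra hlt
      have hC := totalDegree_eq_zero_iff_eq_C.1 (show h.totalDegree = 0 by omega)
      obtain ⟨v, hv, hne⟩ := hg
      have h0 := hvan v hv
      apply hne
      rw [hh v hv]
      rw [hC, eval_C] at h0 ⊢
      rw [h0, mul_zero]
    obtain ⟨q, hq, hqe⟩ := exists_eval_eq_sub_mul_add a h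
    refine ⟨q, ?_, fun v hv => ?_⟩
    · rw [Finset.card_insert_of_notMem ha]
      omega
    · rw [hh v hv, hqe v, hvan v hv, Finset.prod_insert ha]
      ring

/-- The Alon–Füredi theorem: a polynomial of degree at most `D` that does not vanish
identically on a finite grid has at least `∏ y i` non-zeros there, for some `y` in the box
`∏ [1, |B i|]` with `∑ (|B i| - y i) ≤ D`. -/
theorem exists_prod_le_card_eval_ne_zero [DecidableEq K] (n : ℕ) :
    ∀ (B : Fin n → Finset K) (D : ℕ) (g : MvPolynomial (Fin n) K), g.totalDegree ≤ D →
    (∃ v, (∀ i, v i ∈ B i) ∧ eval v g ≠ 0) →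
    ∃ y : Fin n → ℕ, (∀ i, 1 ≤ y i ∧ y i ≤ (B i).card) ∧ ∑ i, ((B i).card - y i) ≤ D ∧
      ∏ i, y i ≤ ((Fintype.piFinset B).filter fun v => eval v g ≠ 0).card := by
  induction n with
  | zero =>
    rintro B D g - ⟨v, hv, hne⟩
    refine ⟨fun i => i.elim0, fun i => i.elim0, by simp, ?_⟩
    simp only [Finset.univ_eq_empty, Finset.prod_empty]
    exact Finset.card_pos.2 ⟨v, Finset.mem_filter.2 ⟨Fintype.mem_piFinset.2 hv, hne⟩⟩
  | succ n ih =>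
    intro B D g hD hg
    set B' : Fin n → Finset K := fun i => B i.succ with hB'
    -- `N` and `Z` split the values of `x₀` by whether `g` is somewhere non-zero on the slice.
    -- Dividing out `Z` costs `Z.card` of the degree, which is the defect of the choice `y 0 =
    -- N.card`.
    set N : Finset K := (B 0).filter fun a =>
      ∃ x ∈ Fintype.piFinset B', eval (Fin.cons a x : Fin (n + 1) → K) g ≠ 0 with hN
    set Z : Finset K := (B 0).filter fun a =>
      ¬ ∃ x ∈ Fintype.piFinset B', eval (Fin.cons a x : Fin (n + 1) → K) g ≠ 0 with hZ
    have hcard : N.card + Z.card = (B 0).card := Finset.card_filter_add_card_filter_not _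
    obtain ⟨h, hdeg, hh⟩ := exists_eval_eq_prod_mul B g hg Z (Finset.filter_subset _ _) (by
      intro a ha v hv hva
      have := (Finset.mem_filter.1 ha).2
      push Not at this
      have h0 := this (Fin.tail v) (Fintype.mem_piFinset.2 fun i => hv i.succ)
      rwa [← hva, Fin.cons_self_tail] at h0)
    have hNne : N.Nonempty := by
      obtain ⟨v, hv, hne⟩ := hg
      refine ⟨v 0, Finset.mem_filter.2 ⟨hv 0, Fin.tail v,
        Fintype.mem_piFinset.2 fun i => hv i.succ, ?_⟩⟩
      rwa [Fin.cons_self_tail]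
    -- The `y` from the induction hypothesis depends on the slice; taking a slice with the fewest
    -- non-zeros makes one `y` valid for all slices over `N`.
    obtain ⟨a, haN, hmin⟩ := Finset.exists_min_image N (fun a =>
      ((Fintype.piFinset B').filter fun x =>
        eval (Fin.cons a x : Fin (n + 1) → K) g ≠ 0).card) hNne
    obtain ⟨haB, x, hx, hxne⟩ := Finset.mem_filter.1 haN
    have hmem : ∀ x ∈ Fintype.piFinset B', ∀ b ∈ B 0, ∀ i,
        (Fin.cons b x : Fin (n + 1) → K) i ∈ B i := by
      intro x hx b hb i
      refine Fin.cases ?_ (fun j => ?_) i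
      · simpa using hb
      · simpa using Fintype.mem_piFinset.1 hx j
    obtain ⟨y, hy, hsum, hprod⟩ := ih B' (D - Z.card) (restrictZero a h)
      ((totalDegree_restrictZero_le a h).trans (by omega))
      ⟨x, Fintype.mem_piFinset.1 hx, by
        rw [eval_restrictZero]
        intro h0
        apply hxne
        rw [hh _ (hmem x hx a haB), h0, mul_zero]⟩
    have hNpos : 1 ≤ N.card := Finset.card_pos.2 hNne
    refine ⟨Fin.cons N.card y, fun i => ?_, ?_, ?_⟩
    · refine Fin.cases ?_ (fun j => ?_) i
      · simp only [Fin.cons_zero]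
        omega
      · simpa using hy j
    · rw [Fin.sum_univ_succ]
      simp only [Fin.cons_zero, Fin.cons_succ]
      have : ∑ i : Fin n, ((B i.succ).card - y i) ≤ D - Z.card := hsum
      omega
    · rw [Fin.prod_univ_succ]
      simp only [Fin.cons_zero, Fin.cons_succ]
      have hle : ((Fintype.piFinset B').filter fun x => eval x (restrictZero a h) ≠ 0).card ≤
          ((Fintype.piFinset B').filter fun x =>
            eval (Fin.cons a x : Fin (n + 1) → K) g ≠ 0).card := by
        refine Finset.card_le_card fun x hx => ?_
        obtain ⟨hxB, hxh⟩ := Finset.mem_filter.1 hx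
        refine Finset.mem_filter.2 ⟨hxB, ?_⟩
        rw [hh _ (hmem x hxB a haB)]
        refine mul_ne_zero (Finset.prod_ne_zero_iff.2 fun b hb => ?_)
          (by rwa [← eval_restrictZero])
        simp only [Fin.cons_zero]
        refine sub_ne_zero.2 fun hab => ?_
        subst hab
        exact (Finset.mem_filter.1 hb).2 (Finset.mem_filter.1 haN).2
      calc N.card * ∏ i, y i
          ≤ ∑ b ∈ N, ((Fintype.piFinset B').filter fun x =>
              eval (Fin.cons b x : Fin (n + 1) → K) g ≠ 0).card := by
            rw [← smul_eq_mul]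
            exact Finset.card_nsmul_le_sum _ _ _ fun b hb =>
              (hprod.trans hle).trans (hmin b hb)
        _ = (N.sigma fun b => (Fintype.piFinset B').filter fun x =>
              eval (Fin.cons b x : Fin (n + 1) → K) g ≠ 0).card := (Finset.card_sigma _ _).symm
        _ ≤ _ := by
            refine Finset.card_le_card_of_injOn
              (fun p => (Fin.cons p.1 p.2 : Fin (n + 1) → K)) ?_ ?_
            · rintro ⟨b, x⟩ hp
              obtain ⟨hb, hx⟩ := Finset.mem_sigma.1 hp
              obtain ⟨hxB, hxg⟩ := Finset.mem_filter.1 hx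
              exact Finset.mem_filter.2 ⟨Fintype.mem_piFinset.2
                (hmem x hxB b (Finset.mem_filter.1 hb).1), hxg⟩
            · rintro ⟨b, x⟩ - ⟨c, z⟩ - hbc
              obtain ⟨rfl, rfl⟩ := Fin.cons_injective2 hbc
              rfl

end Grid

/-! ### The vanishing ideal of a finite set of points -/

section Points

variable {K : Type*} [Field K] {s : ℕ}

theorem sum_eq_of_mem_support {f : MvPolynomial (Fin s) K} {n : ℕ} (hf : f.IsHomogeneous n)
    {m : Fin s →₀ ℕ} (hm : m ∈ f.support) : ∑ i, m i = n := by
  rw [hf.degree_eq_sum_deg_support hm]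
  exact (Finset.sum_subset (Finset.subset_univ _) fun i _ hi => Finsupp.notMem_support_iff.1 hi).symm

theorem eval_smul_of_isHomogeneous {f : MvPolynomial (Fin s) K} {n : ℕ} (hf : f.IsHomogeneous n)
    (a : K) (v : Fin s → K) : eval (a • v) f = a ^ n * eval v f := by
  rw [eval_eq', eval_eq', Finset.mul_sum]
  refine Finset.sum_congr rfl fun m hm => ?_
  have hdeg : ∑ i, m i = n := sum_eq_of_mem_support hf hm
  simp only [Pi.smul_apply, smul_eq_mul, mul_pow, Finset.prod_mul_distrib,
    Finset.prod_pow_eq_pow_sum, hdeg]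
  ring

theorem vanishesAt_mk_iff {f : MvPolynomial (Fin s) K} {n : ℕ} (hf : f.IsHomogeneous n)
    (v : Fin s → K) (hv : v ≠ 0) : VanishesAt f (Projectivization.mk K v hv) ↔ eval v f = 0 := by
  refine ⟨fun h => h v hv rfl, fun h w hw hwv => ?_⟩
  obtain ⟨a, rfl⟩ := (Projectivization.mk_eq_mk_iff' K w v hw hv).1 hwv
  rw [eval_smul_of_isHomogeneous hf, h, mul_zero]

theorem vanishesAt_iff_eval_rep {f : MvPolynomial (Fin s) K} {n : ℕ} (hf : f.IsHomogeneous n)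
    (p : ℙ K (Fin s → K)) : VanishesAt f p ↔ eval p.rep f = 0 := by
  conv_lhs => rw [← p.mk_rep]
  exact vanishesAt_mk_iff hf _ _

theorem vanishesAt_of_mem_projVanishingIdeal {X : Set (ℙ K (Fin s → K))}
    {f : MvPolynomial (Fin s) K} (hf : f ∈ projVanishingIdeal X) : ∀ p ∈ X, VanishesAt f p := by
  refine Submodule.span_induction (p := fun f _ => ∀ p ∈ X, VanishesAt f p)
    (fun f hf => hf.2) ?_ ?_ ?_ hf
  · intro p _ v hv _
    simp
  · intro f g _ _ hf hg p hp v hv hvp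
    simp [hf p hp v hv hvp, hg p hp v hv hvp]
  · intro a f _ hf p hp v hv hvp
    simp [hf p hp v hv hvp]

theorem mem_projVanishingIdeal_iff {X : Set (ℙ K (Fin s → K))} {f : MvPolynomial (Fin s) K}
    {n : ℕ} (hf : f.IsHomogeneous n) :
    f ∈ projVanishingIdeal X ↔ ∀ p ∈ X, VanishesAt f p :=
  ⟨vanishesAt_of_mem_projVanishingIdeal, fun h => Ideal.subset_span ⟨⟨n, hf⟩, h⟩⟩

/-- The restriction of polynomials to the line spanned by `v`. -/
def lineHom (v : Fin s → K) : MvPolynomial (Fin s) K →ₐ[K] Polynomial K :=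
  aeval fun i => Polynomial.C (v i) * Polynomial.X

theorem lineHom_of_isHomogeneous {f : MvPolynomial (Fin s) K} {n : ℕ} (hf : f.IsHomogeneous n)
    (v : Fin s → K) : lineHom v f = Polynomial.C (eval v f) * Polynomial.X ^ n := by
  unfold lineHom
  rw [aeval_eq_eval₂Hom, coe_eval₂Hom, eval₂_eq', eval_eq', map_sum, Finset.sum_mul]
  refine Finset.sum_congr rfl fun m hm => ?_
  have hdeg : ∑ i, m i = n := sum_eq_of_mem_support hf hm
  simp only [mul_pow, Finset.prod_mul_distrib, Finset.prod_pow_eq_pow_sum, hdeg, map_mul, map_prod,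
    map_pow, Polynomial.algebraMap_eq]
  ring

theorem coeff_lineHom (v : Fin s → K) (f : MvPolynomial (Fin s) K) (n : ℕ) :
    (lineHom v f).coeff n = eval v (homogeneousComponent n f) := by
  conv_lhs => rw [← sum_homogeneousComponent f]
  simp only [map_sum, lineHom_of_isHomogeneous (homogeneousComponent_isHomogeneous _ _),
    Polynomial.finsetSum_coeff, Polynomial.coeff_C_mul, Polynomial.coeff_X_pow, mul_ite, mul_one,
    mul_zero, Finset.sum_ite_eq, Finset.mem_range]
  split_ifs with h
  · rfl
  · rw [homogeneousComponent_eq_zero _ _ (by omega), map_zero]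

theorem lineHom_surjective {v : Fin s → K} (hv : v ≠ 0) : Function.Surjective (lineHom v) := by
  obtain ⟨i, hi⟩ := Function.ne_iff.1 hv
  intro q
  refine ⟨Polynomial.aeval (C (v i)⁻¹ * X i) q, ?_⟩
  rw [← Polynomial.aeval_algHom_apply]
  have : lineHom v (C (v i)⁻¹ * X i) = Polynomial.X := by
    have hi' : v i ≠ 0 := hi
    rw [lineHom_of_isHomogeneous (isHomogeneous_C_mul_X _ _)]
    simp [hi']
  rw [this, Polynomial.aeval_X_left_apply]

/-- The coefficients of the restriction to a line are the values of the homogeneous components. Thus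
`I(X)` is an intersection of kernels of maps to `K[T]`, also over a finite field, where values alone
would not separate the components. -/
theorem mem_projVanishingIdeal_iff_lineHom {X : Set (ℙ K (Fin s → K))}
    {f : MvPolynomial (Fin s) K} :
    f ∈ projVanishingIdeal X ↔ ∀ p ∈ X, lineHom p.rep f = 0 := by
  constructor
  · intro hf p hp
    have hle : projVanishingIdeal X ≤ RingHom.ker (lineHom p.rep) := by
      refine Ideal.span_le.2 ?_
      rintro g ⟨⟨n, hg⟩, hgX⟩
      rw [SetLike.mem_coe, RingHom.mem_ker, lineHom_of_isHomogeneous hg,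
        (vanishesAt_iff_eval_rep hg p).1 (hgX p hp)]
      simp
    exact hle hf
  · intro h
    rw [← sum_homogeneousComponent f]
    refine Ideal.sum_mem _ fun n _ => ?_
    have hn := homogeneousComponent_isHomogeneous n f
    rw [mem_projVanishingIdeal_iff hn]
    intro p hp
    rw [vanishesAt_iff_eval_rep hn, ← coeff_lineHom, h p hp, Polynomial.coeff_zero]

/-- A prime containing the finite intersection of line kernels contains one of them, and each kernel
has quotient `K[T]`. A prime strictly above it therefore gives a non-zero prime of `K[T]`, which is
maximal. The surjection onto `K[T]` gives the other inequality. -/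
theorem ringKrullDim_quotient_projVanishingIdeal {X : Set (ℙ K (Fin s → K))} (hX : X.Finite)
    (hne : X.Nonempty) :
    ringKrullDim (MvPolynomial (Fin s) K ⧸ projVanishingIdeal X) = 1 := by
  refine le_antisymm ?_ ?_
  · rw [ringKrullDim_quotient, Order.krullDim_le_one_iff]
    intro P
    rw [or_iff_not_imp_left, not_isMin_iff]
    rintro ⟨Q, hQP⟩
    have hinf : hX.toFinset.inf (fun p => RingHom.ker (lineHom p.rep)) ≤ Q.1.asIdeal := by
      refine le_trans (fun f hf => ?_) Q.2
      rw [mem_projVanishingIdeal_iff_lineHom]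
      intro p hp
      have : f ∈ RingHom.ker (lineHom p.rep) :=
        (Finset.inf_le (f := fun p : ℙ K (Fin s → K) => RingHom.ker (lineHom p.rep))
          (hX.mem_toFinset.2 hp)) hf
      exact this
    obtain ⟨p, -, hp⟩ := (Ideal.IsPrime.inf_le' Q.1.isPrime).1 hinf
    have hsurj := lineHom_surjective p.rep_nonzero
    have hlt : Q.1.asIdeal < P.1.asIdeal := hQP
    have hker : RingHom.ker (lineHom p.rep) ≤ P.1.asIdeal := hp.trans hlt.le
    have hprime : (P.1.asIdeal.map (lineHom p.rep)).IsPrime :=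
      Ideal.map_isPrime_of_surjective hsurj hker
    have hcomap : (P.1.asIdeal.map (lineHom p.rep)).comap (lineHom p.rep) = P.1.asIdeal := by
      rw [Ideal.comap_map_of_surjective _ hsurj]
      exact sup_eq_left.2 hker
    have hbot : P.1.asIdeal.map (lineHom p.rep) ≠ ⊥ := by
      intro hb
      rw [hb] at hcomap
      exact hlt.not_ge (hcomap.symm.le.trans hp)
    have hmax := hprime.isMaximal hbot
    have hPmax : P.1.asIdeal.IsMaximal := by
      rw [← hcomap]
      exact Ideal.comap_isMaximal_of_surjective _ hsurj
    intro R hPR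
    have : P.1.asIdeal = R.1.asIdeal := hPmax.eq_of_le R.1.isPrime.ne_top hPR
    exact this.ge
  · obtain ⟨p, hp⟩ := hne
    rw [← IsPrincipalIdealRing.ringKrullDim_eq_one (Polynomial K) (Polynomial.not_isField K)]
    refine ringKrullDim_le_of_surjective
      (Ideal.Quotient.lift (projVanishingIdeal X) (lineHom p.rep : _ →+* Polynomial K)
        fun f hf => mem_projVanishingIdeal_iff_lineHom.1 hf p hp) ?_
    exact Ideal.Quotient.lift_surjective_of_surjective _ _ (lineHom_surjective p.rep_nonzero)

theorem exists_linear_separating {p q : ℙ K (Fin s → K)} (hpq : q ≠ p) :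
    ∃ f : MvPolynomial (Fin s) K, f.IsHomogeneous 1 ∧ eval q.rep f = 0 ∧ eval p.rep f ≠ 0 := by
  by_contra! hcon
  obtain ⟨i, hi⟩ := Function.ne_iff.1 q.rep_nonzero
  have hi' : q.rep i ≠ 0 := hi
  apply hpq
  rw [← q.mk_rep, ← p.mk_rep, eq_comm, Projectivization.mk_eq_mk_iff']
  refine ⟨p.rep i / q.rep i, funext fun j => ?_⟩
  -- If all these 2 by 2 minors vanish at `p`, the two representatives are proportional.
  have := hcon (C (q.rep i) * X j - C (q.rep j) * X i)
    ((isHomogeneous_C_mul_X _ _).sub (isHomogeneous_C_mul_X _ _)) (by simp; ring)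
  simp only [map_sub, map_mul, eval_C, eval_X] at this
  simp only [Pi.smul_apply, smul_eq_mul]
  field_simp
  linear_combination -this

/-- Evaluation of forms of degree `n` at fixed representatives of the points of `X`. -/
def evalRep (X : Set (ℙ K (Fin s → K))) (n : ℕ) :
    homogeneousSubmodule (Fin s) K n →ₗ[K] (X → K) where
  toFun f := fun x => eval x.1.rep (f : MvPolynomial (Fin s) K)
  map_add' f f' := by
    funext x
    simp
  map_smul' c f := by
    funext x
    simp

theorem ker_evalRep (X : Set (ℙ K (Fin s → K))) (n : ℕ) :
    LinearMap.ker (evalRep X n) =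
      ((projVanishingIdeal X).restrictScalars K).submoduleOf (homogeneousSubmodule (Fin s) K n) := by
  ext ⟨f, hf⟩
  have hf' : f.IsHomogeneous n := hf
  rw [LinearMap.mem_ker, Submodule.submoduleOf, Submodule.mem_comap, Submodule.subtype_apply,
    Submodule.restrictScalars_mem, mem_projVanishingIdeal_iff hf', funext_iff, Subtype.forall]
  exact forall₂_congr fun p _ => (vanishesAt_iff_eval_rep hf' p).symm

theorem range_evalRep (X : Set (ℙ K (Fin s → K))) [Fintype X] {n : ℕ} (hn : Fintype.card X ≤ n) :
    LinearMap.range (evalRep X n) = ⊤ := by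
  classical
  rw [eq_top_iff, ← (Pi.basisFun K X).span_eq, Submodule.span_le]
  rintro _ ⟨p, rfl⟩
  choose! l hl1 hl2 hl3 using fun q : X => fun h : (q : ℙ K (Fin s → K)) ≠ p =>
    exists_linear_separating h
  obtain ⟨j, hj⟩ := Function.ne_iff.1 p.1.rep_nonzero
  have hj' : p.1.rep j ≠ 0 := hj
  have hne : ∀ q ∈ Finset.univ.erase p, (q : ℙ K (Fin s → K)) ≠ p := fun q hq h =>
    (Finset.mem_erase.1 hq).1 (Subtype.ext h)
  -- One linear form kills each point other than `p`; a power of a coordinate that is non-zero at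
  -- `p` raises the degree to `n`.
  set g : MvPolynomial (Fin s) K :=
    MvPolynomial.X j ^ (n - (Fintype.card X - 1)) * ∏ q ∈ Finset.univ.erase p, l q with hgdef
  have hg : g.IsHomogeneous n := by
    have h1 := (isHomogeneous_X_pow (R := K) j (n - (Fintype.card X - 1))).mul
      (IsHomogeneous.prod (Finset.univ.erase p) l (fun _ => 1) fun q hq => hl1 q (hne q hq))
    have hpos : 1 ≤ Fintype.card X := Fintype.card_pos_iff.2 ⟨p⟩
    simp only [Finset.sum_const, smul_eq_mul, mul_one, Finset.card_erase_of_mem (Finset.mem_univ p),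
      Finset.card_univ] at h1
    rwa [show n - (Fintype.card X - 1) + (Fintype.card X - 1) = n by omega] at h1
  have hgp : eval p.1.rep g ≠ 0 := by
    rw [hgdef, map_mul, map_pow, eval_X, map_prod]
    exact mul_ne_zero (pow_ne_zero _ hj')
      (Finset.prod_ne_zero_iff.2 fun q hq => hl3 q (hne q hq))
  refine ⟨(eval p.1.rep g)⁻¹ • ⟨g, hg⟩, funext fun q => ?_⟩
  rw [map_smul, Pi.smul_apply, Pi.basisFun_apply]
  change (eval p.1.rep g)⁻¹ * eval q.1.rep g = _
  by_cases hqp : q = p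
  · subst hqp
    rw [inv_mul_cancel₀ hgp, Pi.single_eq_same]
  · have hgq : eval q.1.rep g = 0 := by
      rw [hgdef, map_mul, map_prod, Finset.prod_eq_zero (Finset.mem_erase.2 ⟨hqp, Finset.mem_univ q⟩)
        (hl2 q fun h => hqp (Subtype.ext h)), mul_zero]
    rw [Pi.single_eq_of_ne hqp, hgq, mul_zero]

theorem hilbertFunction_projVanishingIdeal (X : Set (ℙ K (Fin s → K))) [Fintype X] {n : ℕ}
    (hn : Fintype.card X ≤ n) : hilbertFunction (projVanishingIdeal X) n = Fintype.card X := by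
  unfold hilbertFunction
  rw [← ker_evalRep, ((evalRep X n).quotKerEquivOfSurjective
    (LinearMap.range_eq_top.1 (range_evalRep X hn))).finrank_eq, Module.finrank_fintype_fun_eq_card]

/-- The degree of a finite non-empty set of points is its cardinality. -/
theorem hasDegree_projVanishingIdeal (X : Set (ℙ K (Fin s → K))) [Fintype X] (hne : X.Nonempty) :
    HasDegree (projVanishingIdeal X) (Fintype.card X) := by
  refine ⟨1, ?_, Or.inl ⟨le_rfl, ?_⟩⟩
  · simpa using ringKrullDim_quotient_projVanishingIdeal X.toFinite hne
  · refine tendsto_const_nhds.congr' ?_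
    filter_upwards [Filter.eventually_ge_atTop (Fintype.card X)] with n hn
    simp [hilbertFunction_projVanishingIdeal X hn]

end Points

/-! ### Sizes of the sets and the decomposition of the degree -/

section Sizes

variable {K : Type*} {s : ℕ}

/-- The sequence `d_2, d_3, …` of cardinalities, indexed from zero. -/
def sizeSeq (A : Fin s → Finset K) (i : ℕ) : ℕ :=
  if h : i + 1 < s then (A ⟨i + 1, h⟩).card else 0

theorem sizeSeq_eq (A : Fin s → Finset K) {i : ℕ} (h : i + 1 < s) :
    sizeSeq A i = (A ⟨i + 1, h⟩).card := dif_pos h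

theorem card_eq_sizeSeq [NeZero s] (A : Fin s → Finset K) {i : Fin s} (hi : 0 < i) :
    (A i).card = sizeSeq A (i.val - 1) := by
  have h0 : 0 < i.val := hi
  rw [sizeSeq_eq A (by omega)]
  congr 2
  exact Fin.ext (by simp; omega)

theorem sum_Ioo_zero_eq [NeZero s] (A : Fin s → Finset K) {k : ℕ} (hk : k + 1 < s) :
    ∑ i ∈ Finset.Ioo (0 : Fin s) ⟨k + 1, hk⟩, ((A i).card - 1) =
      ∑ i ∈ Finset.range k, (sizeSeq A i - 1) := by
  have h1 : ∑ i ∈ Finset.Ioo (0 : Fin s) ⟨k + 1, hk⟩, ((A i).card - 1) =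
      ∑ i ∈ Finset.Ioo (0 : Fin s) ⟨k + 1, hk⟩,
        (fun j => sizeSeq A (j - 1) - 1) (Fin.valEmbedding i) :=
    Finset.sum_congr rfl fun i hi => by
      rw [card_eq_sizeSeq A (Finset.mem_Ioo.1 hi).1]
      rfl
  rw [h1, ← Finset.sum_map _ Fin.valEmbedding (fun j => sizeSeq A (j - 1) - 1), Fin.map_valEmbedding_Ioo]
  have h2 : Finset.Ioo ((0 : Fin s) : ℕ) ((⟨k + 1, hk⟩ : Fin s) : ℕ) = Finset.Ico 1 (k + 1) := by
    ext i
    simp only [Finset.mem_Ioo, Finset.mem_Ico, Fin.val_zero]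
    omega
  rw [h2, Finset.sum_Ico_eq_sum_range]
  simp

theorem sum_Ioi_zero_eq [NeZero s] (A : Fin s → Finset K) :
    ∑ i ∈ Finset.Ioi (0 : Fin s), ((A i).card - 1) =
      ∑ i ∈ Finset.range (s - 1), (sizeSeq A i - 1) := by
  have h1 : ∑ i ∈ Finset.Ioi (0 : Fin s), ((A i).card - 1) =
      ∑ i ∈ Finset.Ioi (0 : Fin s), (fun j => sizeSeq A (j - 1) - 1) (Fin.valEmbedding i) :=
    Finset.sum_congr rfl fun i hi => by
      rw [card_eq_sizeSeq A (Finset.mem_Ioi.1 hi)]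
      rfl
  rw [h1, ← Finset.sum_map _ Fin.valEmbedding (fun j => sizeSeq A (j - 1) - 1), Fin.map_valEmbedding_Ioi]
  have h2 : Finset.Ioo ((0 : Fin s) : ℕ) s = Finset.Ico 1 s := by
    ext i
    simp only [Finset.mem_Ioo, Finset.mem_Ico, Fin.val_zero]
    omega
  rw [h2, Finset.sum_Ico_eq_sum_range]
  simp

theorem prod_Ioi_eq [NeZero s] (A : Fin s → Finset K) {k : ℕ} (hk : k + 1 < s) :
    ∏ i ∈ Finset.Ioi (⟨k + 1, hk⟩ : Fin s), (A i).card =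
      ∏ i ∈ Finset.range (s - (k + 2)), sizeSeq A (k + 1 + i) := by
  have h1 : ∏ i ∈ Finset.Ioi (⟨k + 1, hk⟩ : Fin s), (A i).card =
      ∏ i ∈ Finset.Ioi (⟨k + 1, hk⟩ : Fin s),
        (fun j => sizeSeq A (j - 1)) (Fin.valEmbedding i) :=
    Finset.prod_congr rfl fun i hi => by
      have h : k + 1 < i.val := Fin.lt_def.1 (Finset.mem_Ioi.1 hi)
      have h0 : (0 : Fin s) < i := Fin.lt_def.2 (by rw [Fin.val_zero]; omega)
      rw [card_eq_sizeSeq A h0]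
      rfl
  rw [h1, ← Finset.prod_map _ Fin.valEmbedding (fun j => sizeSeq A (j - 1)), Fin.map_valEmbedding_Ioi]
  have h2 : Finset.Ioo ((⟨k + 1, hk⟩ : Fin s) : ℕ) s = Finset.Ico (k + 2) s := by
    ext i
    simp only [Finset.mem_Ioo, Finset.mem_Ico]
    omega
  rw [h2, Finset.prod_Ico_eq_prod_range]
  refine Finset.prod_congr rfl fun i _ => ?_
  congr 1
  omega

theorem isDecomposition_iff [NeZero s] (A : Fin s → Finset K) {d k l : ℕ} :
    IsDecomposition A d k l ↔ k + 1 < s ∧ d = ∑ i ∈ Finset.range k, (sizeSeq A i - 1) + l ∧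
      1 ≤ l ∧ l ≤ sizeSeq A k - 1 := by
  constructor
  · rintro ⟨hk, h1, h2, h3⟩
    rw [sum_Ioo_zero_eq] at h1
    exact ⟨hk, h1, h2, by rwa [sizeSeq_eq A hk]⟩
  · rintro ⟨hk, h1, h2, h3⟩
    refine ⟨hk, ?_, h2, by rwa [sizeSeq_eq A hk] at h3⟩
    rwa [sum_Ioo_zero_eq]

theorem existsUnique_isDecomposition [NeZero s] (A : Fin s → Finset K) {d : ℕ} (hd1 : 1 ≤ d)
    (hd : d ≤ ∑ i ∈ Finset.Ioi (0 : Fin s), ((A i).card - 1)) :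
    ∃! p : ℕ × ℕ, IsDecomposition A d p.1 p.2 := by
  classical
  rw [sum_Ioi_zero_eq] at hd
  -- `k + 1` is the least number of terms whose partial sum reaches `d`, and `ℓ` is the excess over
  -- the partial sum of `k` terms.
  have hex : ∃ j, d ≤ ∑ i ∈ Finset.range j, (sizeSeq A i - 1) := ⟨_, hd⟩
  have hle : Nat.find hex ≤ s - 1 := Nat.find_min' hex hd
  have hspec := Nat.find_spec hex
  have hmin := fun j => Nat.find_min hex (m := j)
  generalize Nat.find hex = j at *
  rcases j with _ | k
  · simp at hspec
    omega
  have hk := hmin k (by omega)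
  rw [Finset.sum_range_succ] at hspec
  have hmono : Monotone fun j => ∑ i ∈ Finset.range j, (sizeSeq A i - 1) := fun a b hab =>
    Finset.sum_le_sum_of_subset (Finset.range_mono hab)
  refine ⟨(k, d - ∑ i ∈ Finset.range k, (sizeSeq A i - 1)), ?_, ?_⟩
  · exact (isDecomposition_iff A).2 ⟨by omega, by dsimp only; omega, by dsimp only; omega,
      by dsimp only; omega⟩
  · rintro ⟨k', l'⟩ h
    obtain ⟨-, h1, h2, h3⟩ := (isDecomposition_iff A).1 h
    dsimp only at h1 h2 h3
    have hkk : k' = k := by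
      rcases lt_trichotomy k' k with hlt | heq | hgt
      · have := hmono (show k' + 1 ≤ k from hlt)
        dsimp only at this
        rw [Finset.sum_range_succ] at this
        omega
      · exact heq
      · have := hmono (show k + 1 ≤ k' from hgt)
        dsimp only at this
        rw [Finset.sum_range_succ] at this
        omega
    subst hkk
    rw [Prod.mk.injEq]
    exact ⟨rfl, by omega⟩

end Sizes

/-! ### Forms divisible by the first variable -/

section Forms

variable {K : Type*} [Field K]

theorem mem_monomialSpan_iff {n d : ℕ} (hd : 1 ≤ d) {f : MvPolynomial (Fin (n + 1)) K} :
    f ∈ monomialSpan K (n + 1) d ↔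
      ∃ h : MvPolynomial (Fin (n + 1)) K, h.IsHomogeneous (d - 1) ∧ f = X 0 * h := by
  constructor
  · intro hf
    refine Submodule.span_induction (p := fun f _ => ∃ h : MvPolynomial (Fin (n + 1)) K,
      h.IsHomogeneous (d - 1) ∧ f = X 0 * h) ?_ ?_ ?_ ?_ hf
    · rintro _ ⟨a, ha, ha0, rfl⟩
      have hle : Finsupp.single 0 1 ≤ a := Finsupp.single_le_iff.2 ha0
      refine ⟨monomial (a - Finsupp.single 0 1) 1, isHomogeneous_monomial _ ?_, ?_⟩
      · have h1 : (a - Finsupp.single 0 1 + Finsupp.single 0 1).degree = d := by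
          rw [tsub_add_cancel_of_le hle, ha]
        rw [map_add, Finsupp.degree_single] at h1
        omega
      · rw [X, monomial_mul, one_mul, add_tsub_cancel_of_le hle]
    · exact ⟨0, isHomogeneous_zero _ _ _, by simp⟩
    · rintro _ _ _ _ ⟨h, hh, rfl⟩ ⟨h', hh', rfl⟩
      exact ⟨h + h', hh.add hh', by ring⟩
    · rintro c _ _ ⟨h, hh, rfl⟩
      exact ⟨C c * h, hh.C_mul c, by rw [smul_eq_C_mul]; ring⟩
  · rintro ⟨h, hh, rfl⟩
    rw [h.as_sum, Finset.mul_sum]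
    refine Submodule.sum_mem _ fun m hm => ?_
    have : X 0 * monomial m (coeff m h) =
        coeff m h • monomial (Finsupp.single 0 1 + m) (1 : K) := by
      rw [X, monomial_mul, one_mul, smul_monomial, smul_eq_mul, mul_one]
    rw [this]
    refine Submodule.smul_mem _ _ (Submodule.subset_span ⟨_, ?_, by simp, rfl⟩)
    have hdeg : m.degree = d - 1 := by
      by_contra hne
      exact mem_support_iff.1 hm (hh.coeff_eq_zero hne)
    rw [map_add, Finsupp.degree_single, hdeg]
    omega

theorem isHomogeneous_of_mem_monomialSpan {s d : ℕ} [NeZero s] {f : MvPolynomial (Fin s) K}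
    (hf : f ∈ monomialSpan K s d) : f.IsHomogeneous d := by
  have hle : monomialSpan K s d ≤ homogeneousSubmodule (Fin s) K d := by
    refine Submodule.span_le.2 ?_
    rintro _ ⟨a, ha, -, rfl⟩
    exact isHomogeneous_monomial _ ha
  exact hle hf

/-- The points of `X` at which `f` does not vanish. -/
def nonzeroSet {s : ℕ} (X : Set (ℙ K (Fin s → K))) (f : MvPolynomial (Fin s) K) :
    Set (ℙ K (Fin s → K)) :=
  {p | p ∈ X ∧ ¬ VanishesAt f p}

theorem ncard_zeroSet_add_ncard_nonzeroSet {s : ℕ} (X : Set (ℙ K (Fin s → K))) [Fintype X]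
    (f : MvPolynomial (Fin s) K) :
    (zeroSet X f).ncard + (nonzeroSet X f).ncard = Fintype.card X := by
  have hX : X.Finite := X.toFinite
  have h1 : (zeroSet X f).Finite := hX.subset fun p hp => hp.1
  have h2 : (nonzeroSet X f).Finite := hX.subset fun p hp => hp.1
  rw [← Set.ncard_union_eq (Set.disjoint_left.2 fun p hp hp' => hp'.2 hp.2) h1 h2,
    ← Nat.card_eq_fintype_card, Nat.card_coe_set_eq]
  congr 1
  ext p
  simp only [zeroSet, nonzeroSet, Set.mem_union, Set.mem_ofPred_eq]
  tauto

theorem cons_one_ne_zero {n : ℕ} (x : Fin n → K) : (Fin.cons 1 x : Fin (n + 1) → K) ≠ 0 := by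
  intro h
  have := congrFun h 0
  simp at this

theorem ncard_nonzeroSet_X_mul [DecidableEq K] {n : ℕ} {A : Fin (n + 1) → Finset K}
    (hA : IsNested A) {h : MvPolynomial (Fin (n + 1)) K} {e : ℕ} (hh : h.IsHomogeneous e) :
    (nonzeroSet (cartesianSet A) (X 0 * h)).ncard =
      ((Fintype.piFinset fun i : Fin n => A i.succ).filter fun x =>
        eval (Fin.cons 1 x : Fin (n + 1) → K) h ≠ 0).card := by
  have hf : (X 0 * h).IsHomogeneous (1 + e) := (isHomogeneous_X K 0).mul hh
  have himage : nonzeroSet (cartesianSet A) (X 0 * h) =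
      (fun x : Fin n → K => Projectivization.mk K (Fin.cons 1 x : Fin (n + 1) → K)
        (cons_one_ne_zero x)) ''
      ((Fintype.piFinset fun i : Fin n => A i.succ).filter fun x =>
        eval (Fin.cons 1 x : Fin (n + 1) → K) h ≠ 0 : Finset (Fin n → K)) := by
    ext p
    simp only [nonzeroSet, Set.mem_ofPred_eq, Set.mem_image, Finset.coe_filter,
      Fintype.mem_piFinset]
    constructor
    · rintro ⟨⟨v, hv, hvA, rfl⟩, hne⟩
      rw [vanishesAt_mk_iff hf, map_mul, eval_X, mul_eq_zero, not_or] at hne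
      obtain ⟨hv0, hvh⟩ := hne
      have hsmul : v = v 0 • (Fin.cons 1 fun i : Fin n => v i.succ / v 0 : Fin (n + 1) → K) := by
        funext i
        refine Fin.cases ?_ (fun j => ?_) i
        · simp
        · simp only [Pi.smul_apply, Fin.cons_succ, smul_eq_mul]
          field_simp
      refine ⟨fun i => v i.succ / v 0,
        ⟨fun i => hA.div_mem 0 i.succ i.succ_pos _ (hvA _) _ (hvA 0) hv0, fun h0 => ?_⟩, ?_⟩
      · apply hvh
        rw [hsmul, eval_smul_of_isHomogeneous hh, h0, mul_zero]
      · rw [eq_comm, Projectivization.mk_eq_mk_iff']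
        exact ⟨v 0, hsmul.symm⟩
    · rintro ⟨x, ⟨hxA, hxh⟩, rfl⟩
      refine ⟨⟨Fin.cons 1 x, cons_one_ne_zero x, fun i => ?_, rfl⟩, ?_⟩
      · refine Fin.cases ?_ (fun j => ?_) i
        · simpa using hA.one_mem 0
        · simpa using hxA j
      · rw [vanishesAt_mk_iff hf]
        simpa using hxh
  rw [himage, Set.ncard_image_of_injective, Set.ncard_coe_finset]
  intro x y hxy
  obtain ⟨a, ha⟩ := (Projectivization.mk_eq_mk_iff' K _ _ _ _).1 hxy
  have h0 := congrFun ha 0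
  simp only [Pi.smul_apply, Fin.cons_zero, smul_eq_mul, mul_one] at h0
  rw [h0, one_smul] at ha
  exact ((Fin.cons_injective2 ha).2).symm

theorem notMem_projVanishingIdeal_iff {s e : ℕ} {X : Set (ℙ K (Fin s → K))}
    {f : MvPolynomial (Fin s) K} (hf : f.IsHomogeneous e) :
    f ∉ projVanishingIdeal X ↔ (nonzeroSet X f).Nonempty := by
  rw [mem_projVanishingIdeal_iff hf]
  push Not
  exact Iff.rfl

theorem proposedDistance_le_ncard_nonzeroSet [DecidableEq K] {n : ℕ} {A : Fin (n + 1) → Finset K}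
    (hA : IsNested A) {d k l : ℕ} (hd : 1 ≤ d) (hk : k + 1 < n + 1) (hdec : IsDecomposition A d k l)
    {f : MvPolynomial (Fin (n + 1)) K} (hf : f ∈ monomialSpan K (n + 1) d)
    [Finite (cartesianSet A)] (hfI : f ∉ projVanishingIdeal (cartesianSet A)) :
    proposedDistance A k l hk ≤ (nonzeroSet (cartesianSet A) f).ncard := by
  rw [notMem_projVanishingIdeal_iff (isHomogeneous_of_mem_monomialSpan hf)] at hfI
  obtain ⟨h, hh, rfl⟩ := (mem_monomialSpan_iff hd).1 hf
  obtain ⟨-, hd', hl1, hl2⟩ := (isDecomposition_iff A).1 hdec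
  have hpos := (Set.ncard_pos ((Set.toFinite (cartesianSet A)).subset
    fun p hp => hp.1)).2 hfI
  rw [ncard_nonzeroSet_X_mul hA hh] at hpos ⊢
  obtain ⟨x, hx⟩ := Finset.card_pos.1 hpos
  obtain ⟨hxA, hxh⟩ := Finset.mem_filter.1 hx
  obtain ⟨y, hy, hsum, hprod⟩ := exists_prod_le_card_eval_ne_zero n (fun i : Fin n => A i.succ)
    (d - 1) (restrictZero 1 h) ((totalDegree_restrictZero_le 1 h).trans hh.totalDegree_le)
    ⟨x, Fintype.mem_piFinset.1 hxA, by rwa [eval_restrictZero]⟩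
  simp only [eval_restrictZero] at hprod
  refine le_trans ?_ hprod
  have hsize : ∀ i : Fin n, sizeSeq A i = (A i.succ).card := fun i => sizeSeq_eq A (by omega)
  -- With `m = d_{k+2} - ℓ + 1` the defect allowed in the last greedy slot is `ℓ - 1`, so the total
  -- is `d - 1`.
  have key := mul_prod_le_prod n (sizeSeq A) (fun i => if hi : i < n then y ⟨i, hi⟩ else 0) k
    (sizeSeq A k - l + 1) (n - (k + 1)) (by omega)
    (fun i j hij hj => by
      rw [sizeSeq_eq A (show i + 1 < n + 1 by omega), sizeSeq_eq A (show j + 1 < n + 1 by omega)]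
      exact hA.card_mono _ _ (Fin.mk_le_mk.2 (by omega)))
    (fun i hi => by
      simp only [dif_pos hi]
      rw [sizeSeq_eq A (show i + 1 < n + 1 by omega)]
      exact hy ⟨i, hi⟩)
    (by omega) (by omega) (by
      rw [Finset.sum_range]
      simp only [Fin.is_lt, dif_pos, Fin.eta, hsize]
      omega)
  rw [Finset.prod_range (n := n)] at key
  simp only [Fin.is_lt, dif_pos, Fin.eta] at key
  unfold proposedDistance
  rw [prod_Ioi_eq A hk, ← sizeSeq_eq A hk]
  rwa [show n + 1 - (k + 2) = n - (k + 1) by omega]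

theorem exists_ncard_nonzeroSet_eq [DecidableEq K] {n : ℕ} {A : Fin (n + 1) → Finset K}
    (hA : IsNested A) {d k l : ℕ} (hd : 1 ≤ d) (hk : k + 1 < n + 1)
    (hdec : IsDecomposition A d k l) :
    ∃ f ∈ monomialSpan K (n + 1) d, f ∉ projVanishingIdeal (cartesianSet A) ∧
      (nonzeroSet (cartesianSet A) f).ncard = proposedDistance A k l hk := by
  obtain ⟨_, hd', hl1, hl2⟩ := hdec
  set k' : Fin (n + 1) := ⟨k + 1, hk⟩ with hk'
  have hk0 : (0 : Fin (n + 1)) < k' := Fin.lt_def.2 (Nat.succ_pos k)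
  obtain ⟨T, hTA, hTcard⟩ := Finset.exists_subset_card_eq (s := A k') (n := l - 1) (by omega)
  -- `R i` lists the values of `t_i / t_1` to be killed: every non-zero one before `k'`, which
  -- leaves only 0, then `ℓ - 1` at `k'`, and none afterwards.
  set R : Fin (n + 1) → Finset K := fun i =>
    if i < k' then (A i).erase 0 else if i = k' then T else ∅ with hR
  set h : MvPolynomial (Fin (n + 1)) K :=
    ∏ i ∈ Finset.Ioc 0 k', ∏ c ∈ R i, (MvPolynomial.X i - C c * MvPolynomial.X 0) with hhdef
  have hIoc : Finset.Ioc 0 k' = insert k' (Finset.Ioo 0 k') := (Finset.Ioo_insert_right hk0).symm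
  have hh : h.IsHomogeneous (d - 1) := by
    have h1 : h.IsHomogeneous (∑ i ∈ Finset.Ioc 0 k', ∑ c ∈ R i, 1) :=
      IsHomogeneous.prod _ _ _ fun i _ => IsHomogeneous.prod _ _ _ fun c _ =>
        (isHomogeneous_X _ _).sub (isHomogeneous_C_mul_X _ _)
    have h2 : ∑ i ∈ Finset.Ioc 0 k', ∑ c ∈ R i, 1 = d - 1 := by
      have h3 : ∑ i ∈ Finset.Ioo 0 k', (R i).card = ∑ i ∈ Finset.Ioo 0 k', ((A i).card - 1) :=
        Finset.sum_congr rfl fun i hi => by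
          simp only [hR, if_pos (Finset.mem_Ioo.1 hi).2, Finset.card_erase_of_mem (hA.zero_mem i)]
      have h4 : (R k').card = l - 1 := by simp [hR, hTcard]
      simp only [Finset.sum_const, smul_eq_mul, mul_one]
      rw [hIoc, Finset.sum_insert (by simp), h3, h4]
      omega
    rwa [h2] at h1
  -- `B i` holds the surviving values; the singleton at index 0 stands for the normalized first
  -- coordinate and contributes a factor 1.
  set B : Fin (n + 1) → Finset K := fun i =>
    if i < k' then (if i = 0 then {1} else {0}) else if i = k' then A i \ T else A i with hB
  have hfilter : ((Fintype.piFinset fun i : Fin n => A i.succ).filter fun x =>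
      eval (Fin.cons 1 x : Fin (n + 1) → K) h ≠ 0) = Fintype.piFinset fun i : Fin n => B i.succ := by
    ext x
    have heval : eval (Fin.cons 1 x : Fin (n + 1) → K) h ≠ 0 ↔
        ∀ i : Fin n, i.succ ≤ k' → x i ∉ R i.succ := by
      simp only [hhdef, map_prod, map_sub, map_mul, eval_X, eval_C, Fin.cons_zero, mul_one,
        Finset.prod_ne_zero_iff, sub_ne_zero]
      constructor
      · intro H i hi hx
        exact H i.succ (Finset.mem_Ioc.2 ⟨i.succ_pos, hi⟩) _ hx (by simp)
      · intro H i hi c hc hxc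
        obtain ⟨j, rfl⟩ := Fin.exists_succ_eq.2 (Finset.mem_Ioc.1 hi).1.ne'
        rw [Fin.cons_succ] at hxc
        exact H j (Finset.mem_Ioc.1 hi).2 (hxc ▸ hc)
    rw [Finset.mem_filter, heval, Fintype.mem_piFinset, Fintype.mem_piFinset, ← forall_and]
    refine forall_congr' fun i => ?_
    rcases lt_trichotomy i.succ k' with hi | hi | hi
    · simp only [hR, hB, hi, hi.le, if_true, Fin.succ_ne_zero, if_false, Finset.mem_erase,
        Finset.mem_singleton, forall_const]
      constructor
      · rintro ⟨h1, h2⟩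
        by_contra h0
        exact h2 ⟨h0, h1⟩
      · intro h0
        rw [h0]
        exact ⟨hA.zero_mem _, fun h => h.1 rfl⟩
    · simp [hR, hB, hi]
    · simp [hB, hi.not_ge, hi.not_gt, hi.ne']
  have hcard : (Fintype.piFinset fun i : Fin n => B i.succ).card = proposedDistance A k l hk := by
    have hlt : ∀ i, i < k' → (B i).card = 1 := by
      intro i hi
      simp only [hB, if_pos hi]
      split_ifs <;> simp
    have hBk : (B k').card = (A k').card - l + 1 := by
      simp only [hB, lt_irrefl, if_false, if_true, Finset.card_sdiff_of_subset hTA, hTcard]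
      omega
    have h1 : ∏ i, (B i).card = ∏ i : Fin n, (B i.succ).card := by
      rw [Fin.prod_univ_succ, hlt 0 hk0, one_mul]
    rw [Fintype.card_piFinset, ← h1, ← Finset.mul_prod_erase _ _ (Finset.mem_univ k'), hBk]
    unfold proposedDistance
    congr 1
    rw [← Finset.prod_subset (s₁ := Finset.Ioi k')]
    · refine Finset.prod_congr rfl fun i hi => ?_
      have hi' : k' < i := Finset.mem_Ioi.1 hi
      simp [hB, hi'.not_gt, hi'.ne']
    · intro i hi
      exact Finset.mem_erase.2 ⟨(Finset.mem_Ioi.1 hi).ne', Finset.mem_univ _⟩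
    · intro i hi hi'
      exact hlt i (lt_of_le_of_ne (not_lt.1 fun h => hi' (Finset.mem_Ioi.2 h))
        (Finset.mem_erase.1 hi).1)
  have hmem : MvPolynomial.X 0 * h ∈ monomialSpan K (n + 1) d :=
    (mem_monomialSpan_iff hd).2 ⟨h, hh, rfl⟩
  have hncard : (nonzeroSet (cartesianSet A) (MvPolynomial.X 0 * h)).ncard =
      proposedDistance A k l hk := by
    rw [ncard_nonzeroSet_X_mul hA hh, hfilter, hcard]
  refine ⟨_, hmem, ?_, hncard⟩
  rw [notMem_projVanishingIdeal_iff (isHomogeneous_of_mem_monomialSpan hmem)]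
  refine Set.nonempty_of_ncard_ne_zero ?_
  rw [hncard]
  refine Nat.mul_ne_zero (by omega) (Finset.prod_ne_zero_iff.2 fun i _ => ?_)
  exact Finset.card_ne_zero_of_mem (hA.zero_mem i)

theorem ncard_nonzeroSet_ne_zero_iff {s e : ℕ} {X : Set (ℙ K (Fin s → K))} [Finite X]
    {f : MvPolynomial (Fin s) K} (hf : f.IsHomogeneous e) :
    (nonzeroSet X f).ncard ≠ 0 ↔ f ∉ projVanishingIdeal X := by
  rw [notMem_projVanishingIdeal_iff hf, ← Nat.pos_iff_ne_zero,
    Set.ncard_pos ((Set.toFinite X).subset fun p hp => hp.1)]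

/-- Rescaling a representative or dividing by a non-zero value does not change which entries vanish,
so the weight does not depend on `P` and `g`. -/
theorem hammingNorm_evalMap [DecidableEq K] {s d : ℕ} {X : Set (ℙ K (Fin s → K))} [Fintype X]
    {P : X → Fin s → K} {g : X → MvPolynomial (Fin s) K} (hPg : IsEvalData X d P g)
    (f : homogeneousSubmodule (Fin s) K d) :
    hammingNorm (evalMap X d P g f) = (nonzeroSet X (f : MvPolynomial (Fin s) K)).ncard := by
  have hiff : ∀ x : X, evalMap X d P g f x ≠ 0 ↔ ¬ VanishesAt (f : MvPolynomial (Fin s) K) x := by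
    intro x
    obtain ⟨⟨h, hx⟩, -, hgx⟩ := hPg x
    rw [← hx, vanishesAt_mk_iff f.2]
    exact (div_ne_zero_iff.trans (and_iff_left hgx))
  have himage : nonzeroSet X (f : MvPolynomial (Fin s) K) =
      Subtype.val '' ((Finset.univ.filter fun x : X => evalMap X d P g f x ≠ 0 : Finset X) :
        Set X) := by
    ext p
    simp only [nonzeroSet, Set.mem_ofPred_eq, Set.mem_image, Finset.coe_filter, Finset.mem_univ,
      true_and, hiff, Subtype.exists, exists_and_left, exists_prop, exists_eq_right_right]
    tauto
  rw [himage, Set.ncard_image_of_injective _ Subtype.val_injective, Set.ncard_coe_finset]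
  rfl

end Forms

end

end NestedCartesian
-- The maximal number of zeros and the minimum distance
theorem mainTheorem5 {K : Type*} [Field K] [Finite K] [DecidableEq K]
    (s : ℕ) [NeZero s] (A : Fin s → Finset K) (hA : NestedCartesian.IsNested A)
    [Fintype (NestedCartesian.cartesianSet A)]
    (d : ℕ) (hd1 : 1 ≤ d) (hd : d ≤ ∑ i ∈ Finset.Ioi (0 : Fin s), ((A i).card - 1)) :
    (∃! p : ℕ × ℕ, NestedCartesian.IsDecomposition A d p.1 p.2) ∧
    ∃ e : ℕ,
      NestedCartesian.HasDegree
        (NestedCartesian.projVanishingIdeal (NestedCartesian.cartesianSet A)) e ∧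
      ∀ (k ℓ : ℕ) (hk : k + 1 < s), NestedCartesian.IsDecomposition A d k ℓ →
        IsGreatest
          {n : ℤ | ∃ f ∈ NestedCartesian.monomialSpan K s d,
            f ∉ NestedCartesian.projVanishingIdeal (NestedCartesian.cartesianSet A) ∧
            n = ((NestedCartesian.zeroSet (NestedCartesian.cartesianSet A) f).ncard : ℤ)}
          ((e : ℤ) - (NestedCartesian.proposedDistance A k ℓ hk : ℤ)) ∧
        ∀ (P : NestedCartesian.cartesianSet A → Fin s → K)
          (g : NestedCartesian.cartesianSet A → MvPolynomial (Fin s) K),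
          NestedCartesian.IsEvalData (NestedCartesian.cartesianSet A) d P g →
          NestedCartesian.IsMinimumDistance
            (((NestedCartesian.monomialSpan K s d).submoduleOf
                (MvPolynomial.homogeneousSubmodule (Fin s) K d)).map
              (NestedCartesian.evalMap (NestedCartesian.cartesianSet A) d P g))
            (NestedCartesian.proposedDistance A k ℓ hk) := by
  obtain _ | n := s
  · exact absurd rfl (NeZero.ne 0)
  refine ⟨NestedCartesian.existsUnique_isDecomposition A hd1 hd, Fintype.card _,
    NestedCartesian.hasDegree_projVanishingIdeal _
      ⟨_, 1, one_ne_zero, fun i => hA.one_mem i, rfl⟩, fun k l hk hdec => ?_⟩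
  have hadd := NestedCartesian.ncard_zeroSet_add_ncard_nonzeroSet (NestedCartesian.cartesianSet A)
  obtain ⟨f₀, hf₀, hf₀I, hf₀card⟩ :=
    NestedCartesian.exists_ncard_nonzeroSet_eq hA hd1 hk hdec
  have hle := fun f => NestedCartesian.proposedDistance_le_ncard_nonzeroSet hA hd1 hk hdec (f := f)
  refine ⟨⟨⟨f₀, hf₀, hf₀I, ?_⟩, ?_⟩, fun P g hPg => ?_⟩
  -- The degree `e` is the number of points, so the fewest non-zeros correspond to the most zeros.
  · have := hadd f₀
    omega
  · rintro _ ⟨f, hf, hfI, rfl⟩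
    have h1 := hadd f
    have h2 := hle f hf hfI
    omega
  · have hnorm := NestedCartesian.hammingNorm_evalMap hPg
    refine ⟨⟨_, ⟨⟨f₀, NestedCartesian.isHomogeneous_of_mem_monomialSpan hf₀⟩, hf₀, rfl⟩, ?_, ?_⟩, ?_⟩
    · rw [← hammingNorm_ne_zero_iff, hnorm, hf₀card, ← hf₀card]
      exact (NestedCartesian.ncard_nonzeroSet_ne_zero_iff (NestedCartesian.isHomogeneous_of_mem_monomialSpan hf₀)).2 hf₀I
    · rw [hnorm, hf₀card]
    · rintro _ ⟨_, ⟨f, hf, rfl⟩, hne, rfl⟩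
      rw [hnorm]
      rw [← hammingNorm_ne_zero_iff, hnorm, NestedCartesian.ncard_nonzeroSet_ne_zero_iff f.2] at hne
      exact hle f.1 hf hne
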